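/- **Definitions.** A quasi-order is a set (or class) $Q$ with a reflexive and transitive relation $\le_Q$. Let $[\omega]^\omega$ be the space of infinite subsets of $\omega$ (identified with their increasing enumerations, with the topology of pointwise convergence), and let $S(A)=A\setminus\{\min A\}$. $Q$ is a *better-quasi-order* (BQO) if for every Borel map $f:[\omega]^\omega\to Q$ ($Q$ discrete) there is $A\in[\omega]^\omega$ such that $f(B)\le_Q f(S(B))$ for every infinite $B\subseteq A$. For a countable quasi-order $Q$ let $\vec Q=\{X\in Q^\omega:\forall k\in\omega,\ X(k)\not\le_Q X(k+1)\}$, with the topology of pointwise convergence ($Q$ discrete), regarded as a graph in which distinct $X,Y$ are adjacent iff $Y$ is the shift $(X(k+1))_{k\in\omega}$ of $X$ or $X$ is the shift of $Y$. The Borel chromatic number $\chi_B(G)$ of a graph $G$ on a Polish space is the least cardinality of a Polish space $Y$ for which there is a Borel graph homomorphism from $G$ to the complete graph on $Y$. A countable quasi-order $Q$ is *thin* if it is a BQO and $\chi_B(\vec Q)\le 3$. An arbitrary quasi-order (possibly a proper class) is *thin* if each of its countable subsets, with the inherited order, is thin; for countable $Q$ the two definitions agree. Let $[Q]^{<\omega}$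 be the set of finite subsets of $Q$ with the domination order: $a\le b$ iff for every $x\in a$ there is $y\in b$ with $x\le_Q y$. Let $\mathcal{FT}_Q$ be the class of all pairs $(T,l)$, where $T$ is a finite tree (a finite partial order with a least element, the root, in which the predecessors of each node are well ordered) and $l:T\to Q$ is a labeling. Put $(T_1,l_1)\le_m(T_2,l_2)$ iff there is a map $f:T_1\to T_2$, not necessarily injective, such that $x\le_{T_1}y$ implies $f(x)\le_{T_2}f(y)$ for all $x,y\in T_1$, and $l_1(x)\le_Q l_2(f(x))$ for all $x\in T_1$. **Corollary 3.8.** If $Q$ is a thin quasi-order, then $[Q]^{<\omega}$ with the domination order is thin, and $\mathcal{FT}_Q$ under $\le_m$ is thin. -/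

import Mathlib

universe u v

section BorelGraphs

/-- The Borel chromatic number of a graph `G` on a topological space `V`: the least cardinality
of a Polish space `Y` for which there is a Borel graph homomorphism from `G` to the complete
graph on `Y`. When `V` is Polish the set below is non-empty (take `Y = V`), so that the minimum
is attained. -/
noncomputable def borelChromaticNumber {V : Type u} [TopologicalSpace V] (G : SimpleGraph V) :
    Cardinal.{u} :=
  sInf {κ : Cardinal.{u} | ∃ (Y : Type u) (_ : TopologicalSpace Y), PolishSpace Y ∧
    Cardinal.mk Y = κ ∧ ∃ c : G →g (⊤ : SimpleGraph Y), @Measurable V Y (borel V) (borel Y) c}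

/-- The graph generated by a function `f`: distinct points `x`, `y` are adjacent if and only if
`f x = y` or `f y = x`. -/
def generatedGraph {V : Type u} (f : V → V) : SimpleGraph V :=
  SimpleGraph.fromRel (fun x y => f x = y)

end BorelGraphs

section BetterQuasiOrders

/-- The space of infinite subsets of `ℕ`, each one identified with its strictly increasing
enumeration, with the topology of pointwise convergence (the subspace topology of `ℕ → ℕ`). -/
abbrev InfiniteSubset : Type := {A : ℕ → ℕ // StrictMono A}

/-- The shift `A ↦ A \ {min A}`. -/
def InfiniteSubset.shift (A : InfiniteSubset) : InfiniteSubset :=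
  ⟨fun k => A.1 (k + 1), fun _ _ h => A.2 (Nat.add_lt_add_right h 1)⟩

/-- A quasi-order `Q` is a better-quasi-order if, `Q` being endowed with the discrete topology,
for every Borel map `f` from the space of infinite subsets of `ℕ` to `Q` there is an infinite `A`
such that `f B ≤ f (shift B)` for every infinite `B ⊆ A`. -/
def IsBetterQuasiOrder (Q : Type u) [Preorder Q] : Prop :=
  ∀ f : InfiniteSubset → Q, (∀ U : Set Q, @MeasurableSet _ (borel InfiniteSubset) (f ⁻¹' U)) →
    ∃ A : InfiniteSubset, ∀ B : InfiniteSubset, Set.range B.1 ⊆ Set.range A.1 → f B ≤ f B.shift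

end BetterQuasiOrders

section Thin

/-- The set of all sequences `X` in `Q` with `X k ≰ X (k + 1)` for every `k`. -/
def BadSeq (Q : Type u) [Preorder Q] : Type u :=
  {X : ℕ → Q // ∀ k, ¬ X k ≤ X (k + 1)}

/-- The topology of pointwise convergence, where `Q` is discrete. -/
instance BadSeq.instTopologicalSpace (Q : Type u) [Preorder Q] : TopologicalSpace (BadSeq Q) :=
  TopologicalSpace.induced Subtype.val (@Pi.topologicalSpace ℕ (fun _ => Q) (fun _ => ⊥))

/-- The shift on bad sequences. -/
def BadSeq.shift {Q : Type u} [Preorder Q] (X : BadSeq Q) : BadSeq Q :=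
  ⟨fun k => X.1 (k + 1), fun k => X.2 (k + 1)⟩

/-- Thinness of a countable quasi-order: it is a better-quasi-order and the graph that the shift
generates on its bad sequences has Borel chromatic number at most `3`. -/
def IsCountablyThin (Q : Type u) [Preorder Q] : Prop :=
  IsBetterQuasiOrder Q ∧ borelChromaticNumber (generatedGraph (BadSeq.shift (Q := Q))) ≤ 3

/-- Thinness of an arbitrary quasi-order (or class): all its countable subsets, with the inherited
order, are thin. -/
def IsThin (Q : Type u) [Preorder Q] : Prop :=
  ∀ s : Set Q, s.Countable → IsCountablyThin s

end Thin

section FiniteSubsets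

/-- The finite subsets of `Q` (a copy of `Finset Q`, which does not carry the inclusion order). -/
structure FiniteSubset (Q : Type u) : Type u where
  /-- the underlying finite set -/
  toFinset : Finset Q

/-- The domination order: `a ≤ b` if every element of `a` is below some element of `b`. -/
instance FiniteSubset.instPreorder (Q : Type u) [Preorder Q] : Preorder (FiniteSubset Q) where
  le a b := ∀ x ∈ a.toFinset, ∃ y ∈ b.toFinset, x ≤ y
  le_refl a x hx := ⟨x, hx, le_refl x⟩
  le_trans a b c hab hbc x hx := by
    obtain ⟨y, hy, hxy⟩ := hab x hx
    obtain ⟨z, hz, hyz⟩ := hbc y hy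
    exact ⟨z, hz, hxy.trans hyz⟩

end FiniteSubsets

section FiniteTrees

/-- A finite tree with nodes labelled by elements of `Q`: a finite partial order with a least
element, the root, in which the set of predecessors of each node is well ordered, together with
a map from the nodes to `Q`. -/
structure LabelledFiniteTree (Q : Type u) : Type (max u (v + 1)) where
  /-- the nodes -/
  Node : Type v
  /-- the tree order -/
  order : PartialOrder Node
  finite : Finite Node
  exists_root : ∃ r : Node, ∀ t : Node, r ≤ t
  wellOrdered : ∀ t : Node, IsWellOrder {s : Node // s ≤ t} (fun a b => a < b)
  /-- the labelling -/
  label : Node → Q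

attribute [instance] LabelledFiniteTree.order

/-- The quasi-order `≤_m`: there is a map of the nodes, not necessarily injective, that preserves
the non-strict tree order and does not decrease labels. -/
instance LabelledFiniteTree.instPreorder (Q : Type u) [Preorder Q] :
    Preorder (LabelledFiniteTree.{u, v} Q) where
  le S T := ∃ f : S.Node → T.Node,
    (∀ x y : S.Node, x ≤ y → f x ≤ f y) ∧ ∀ x : S.Node, S.label x ≤ T.label (f x)
  le_refl S := ⟨id, fun _ _ h => h, fun _ => le_refl _⟩
  le_trans R S T := by
    rintro ⟨f, hf, hf'⟩ ⟨g, hg, hg'⟩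
    exact ⟨fun x => g (f x), fun x y h => hg _ _ (hf x y h),
      fun x => (hf' x).trans (hg' (f x))⟩

end FiniteTrees

-- Everything reduces to a Borel selection principle, `IsCountablyThin.of_selection`: if `φ` sends
-- bad sequences in `R` to elements of `Q` in a Borel way and `φ X ≰ φ X.shift`, then the values of
-- `φ` along the shift orbit of `X` form a bad sequence in `Q`. This gives a Borel map commuting
-- with the shifts, and a Borel 3-coloring for `Q` pulls back to one for `R`.
--
-- A finite Borel coloring also forces the better-quasi-order property. By the Galvin–Prikry
-- theorem, a Borel map violating it is bad at every subset of some infinite set; its orbits would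
-- then pull the coloring back to the shift graph on infinite sets, which has no finite Borel
-- coloring.
--
-- For finite sets, `φ X` is an element of `X 0` that no element of `X 1` dominates. For trees, `S ≰
-- T` means that either the root labels fail or a proper subtree of `S` is already not below `T`.
-- Replacing trees by such subtrees, simultaneously at all coordinates and repeatedly, preserves
-- badness and stabilizes at each coordinate; the root labels of the limit trees are then bad.

universe w

/-! ### Fusion and the accept/reject dichotomy -/

/-- The elements of `A` that lie strictly above all elements of the finite set `b`. -/
def aboveFinset (b : Finset ℕ) (A : Set ℕ) : Set ℕ := {m ∈ A | ∀ i ∈ b, i < m}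

theorem aboveFinset_subset (b : Finset ℕ) (A : Set ℕ) : aboveFinset b A ⊆ A := fun _ h => h.1

theorem aboveFinset_mono (b : Finset ℕ) {A B : Set ℕ} (h : A ⊆ B) :
    aboveFinset b A ⊆ aboveFinset b B := fun _ hm => ⟨h hm.1, hm.2⟩

theorem Set.Infinite.aboveFinset {A : Set ℕ} (hA : A.Infinite) (b : Finset ℕ) :
    (aboveFinset b A).Infinite := by
  refine (hA.sdiff (Set.finite_Iic (b.sup id))).mono fun m hm => ⟨hm.1, fun i hi => ?_⟩
  have h1 : i ≤ b.sup id := Finset.le_sup (f := id) hi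
  have h2 : ¬ m ≤ b.sup id := hm.2
  omega

theorem exists_infinite_subset_forall_mem_finset {P : Finset ℕ → Set ℕ → Prop}
    (mono : ∀ b A B, B ⊆ A → B.Infinite → P b A → P b B)
    (dense : ∀ b A, A.Infinite → ∃ B ⊆ A, B.Infinite ∧ P b B)
    (F : Finset (Finset ℕ)) {A : Set ℕ} (hA : A.Infinite) :
    ∃ B ⊆ A, B.Infinite ∧ ∀ b ∈ F, P b B := by
  induction F using Finset.induction_on with
  | empty => exact ⟨A, subset_rfl, hA, by simp⟩
  | insert c F _ ih =>
    obtain ⟨B, hBA, hB, h⟩ := ih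
    obtain ⟨C, hCB, hC, hc⟩ := dense c B hB
    refine ⟨C, hCB.trans hBA, hC, fun b hb => ?_⟩
    rcases Finset.mem_insert.1 hb with rfl | hb
    · exact hc
    · exact mono _ _ _ hCB hC (h b hb)

/-- Fusion: a hereditary dense property of pairs (stem, infinite set) holds below any infinite set
simultaneously for all stems contained in a suitable infinite subset. -/
theorem exists_fusion {P : Finset ℕ → Set ℕ → Prop}
    (mono : ∀ b A B, B ⊆ A → B.Infinite → P b A → P b B)
    (dense : ∀ b A, A.Infinite → ∃ B ⊆ A, B.Infinite ∧ P b B)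
    {A : Set ℕ} (hA : A.Infinite) :
    ∃ B ⊆ A, B.Infinite ∧ ∀ b : Finset ℕ, ↑b ⊆ B → P b (aboveFinset b B) := by
  have hstep : ∀ D : {D : Set ℕ // D.Infinite}, ∃ E : {E : Set ℕ // E.Infinite},
      (∀ m ∈ E.1, m ∈ D.1 ∧ sInf D.1 < m) ∧
        ∀ b : Finset ℕ, (∀ i ∈ b, i ≤ sInf D.1) → P b E.1 := by
    intro D
    obtain ⟨E, hED, hE, hP⟩ := exists_infinite_subset_forall_mem_finset mono dense
      -- Only finitely many stems lie below the current minimum, so all of them are treated at once;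
      -- the fusion set consists of the successive minima.
      (Finset.range (sInf D.1 + 1)).powerset (D.2.aboveFinset {sInf D.1})
    refine ⟨⟨E, hE⟩, fun m hm => ⟨(hED hm).1, (hED hm).2 _ (by simp)⟩, fun b hb => hP b ?_⟩
    exact Finset.mem_powerset.2 fun i hi => Finset.mem_range.2 (Nat.lt_succ_of_le (hb i hi))
  choose step hsub hP using hstep
  obtain ⟨A₀, hA₀A, hA₀, hP₀⟩ := dense ∅ A hA
  let D : ℕ → {D : Set ℕ // D.Infinite} := fun n => step^[n] ⟨A₀, hA₀⟩
  have hD : ∀ n, D (n + 1) = step (D n) := fun n => Function.iterate_succ_apply' step n _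
  have hanti : Antitone fun n => (D n).1 := antitone_nat_of_succ_le fun n m hm => by
    rw [hD] at hm
    exact (hsub _ m hm).1
  have hmem : ∀ n, sInf (D n).1 ∈ (D n).1 := fun n => Nat.sInf_mem (D n).2.nonempty
  have hlt : ∀ n, ∀ m ∈ (D (n + 1)).1, sInf (D n).1 < m := fun n m hm => by
    rw [hD] at hm
    exact (hsub _ m hm).2
  have hstrict : StrictMono fun n => sInf (D n).1 :=
    strictMono_nat_of_lt_succ fun n => hlt n _ (hmem _)
  have hsubA : Set.range (fun n => sInf (D n).1) ⊆ A₀ := by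
    rintro _ ⟨n, rfl⟩
    exact hanti (Nat.zero_le n) (hmem n)
  have hinf : (Set.range fun n => sInf (D n).1).Infinite :=
    Set.infinite_range_of_injective hstrict.injective
  refine ⟨_, hsubA.trans hA₀A, hinf, fun b hb => ?_⟩
  rcases b.eq_empty_or_nonempty with rfl | hne
  · exact mono _ _ _ ((aboveFinset_subset _ _).trans hsubA) (hinf.aboveFinset _) hP₀
  · obtain ⟨n, hn⟩ := hb (b.max'_mem hne)
    have hn : sInf (D n).1 = b.max' hne := hn
    refine mono b (D (n + 1)).1 _ ?_ (hinf.aboveFinset _) ?_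
    · rintro _ ⟨⟨k, rfl⟩, hk⟩
      have h1 := hk _ (b.max'_mem hne)
      rw [← hn] at h1
      exact hanti (hstrict.lt_iff_lt.1 h1) (hmem k)
    · rw [hD]
      exact hP _ b fun i hi => hn ▸ b.le_max' i hi

/-- An abstract form of the Galvin–Nash-Williams dichotomy for accepted and rejected stems. -/
theorem exists_accept_or_forall_reject {Acc : Finset ℕ → Set ℕ → Prop}
    (mono : ∀ b A B, B ⊆ A → B.Infinite → Acc b A → Acc b B)
    (lift : ∀ b A, A.Infinite → (∀ n ∈ A, Acc (insert n b) (aboveFinset {n} A)) → Acc b A)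
    {A : Set ℕ} (hA : A.Infinite) :
    ∃ B ⊆ A, B.Infinite ∧ (Acc ∅ B ∨
      ∀ b : Finset ℕ, ↑b ⊆ B → ∀ C ⊆ aboveFinset b B, C.Infinite → ¬ Acc b C) := by
  let Rej : Finset ℕ → Set ℕ → Prop := fun b A => ∀ C ⊆ A, C.Infinite → ¬ Acc b C
  have rejMono : ∀ b A B, B ⊆ A → Rej b A → Rej b B := fun b A B h hr C hC => hr C (hC.trans h)
  obtain ⟨B, hBA, hB, hdec⟩ := exists_fusion (P := fun b A => Acc b A ∨ Rej b A)
    (fun b A B h hi => Or.imp (mono b A B h hi) (rejMono b A B h))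
    (fun b A hA => by
      by_cases h : ∃ C ⊆ A, C.Infinite ∧ Acc b C
      · obtain ⟨C, hCA, hC, h⟩ := h
        exact ⟨C, hCA, hC, Or.inl h⟩
      · exact ⟨A, subset_rfl, hA, Or.inr fun C hC hi ha => h ⟨C, hC, hi, ha⟩⟩) hA
  have hempty : aboveFinset ∅ B = B := by simp [aboveFinset]
  rcases hdec ∅ (by simp) with hacc | hrej
  · exact ⟨B, hBA, hB, Or.inl (hempty ▸ hacc)⟩
  obtain ⟨C, hCB, hC, hfus⟩ := exists_fusion
    (P := fun b D => ↑b ⊆ B → Rej b (aboveFinset b B) →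
      ∀ n ∈ D, n ∈ B → (∀ i ∈ b, i < n) → Rej (insert n b) (aboveFinset (insert n b) B))
    (fun b A D h _ hP hb hr n hn => hP hb hr n (h hn))
    (fun b A hA => by
      by_cases hb : ↑b ⊆ B ∧ Rej b (aboveFinset b B)
      · let N : Set ℕ := {n | n ∈ aboveFinset b B ∧
          ¬ Rej (insert n b) (aboveFinset (insert n b) B)}
        have hN : N.Finite := by
          by_contra hN
          refine hb.2 N (fun n hn => hn.1) hN (lift b N hN fun n hn => ?_)
          have hsub : (↑(insert n b) : Set ℕ) ⊆ B := by
            rw [Finset.coe_insert]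
            exact Set.insert_subset hn.1.1 hb.1
          refine mono _ _ _ ?_ (Set.Infinite.aboveFinset hN _)
            ((hdec _ hsub).resolve_right hn.2)
          refine fun m hm => ⟨hm.1.1.1, fun i hi => ?_⟩
          rcases Finset.mem_insert.1 hi with rfl | hi
          · exact hm.2 _ (by simp)
          · exact hm.1.1.2 i hi
        refine ⟨A \ N, Set.sdiff_subset, hA.sdiff hN, fun _ _ n hn hnB hlt => ?_⟩
        by_contra h
        exact hn.2 ⟨⟨hnB, hlt⟩, h⟩
      · exact ⟨A, subset_rfl, hA, fun h1 h2 => absurd ⟨h1, h2⟩ hb⟩) hB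
  have key : ∀ b : Finset ℕ, ↑b ⊆ C → Rej b (aboveFinset b B) := by
    intro b
    induction b using Finset.induction_on_max with
    | empty => exact fun _ => hrej
    | insert n b hlt ih =>
      intro hb
      rw [Finset.coe_insert, Set.insert_subset_iff] at hb
      exact hfus b hb.2 (hb.2.trans hCB) (ih hb.2) n ⟨hb.1, hlt⟩ (hCB hb.1) hlt
  exact ⟨C, hCB.trans hBA, hC,
    Or.inr fun b hb => rejMono b _ _ (aboveFinset_mono b hCB) (key b hb)⟩

/-! ### Completely Ramsey families -/

/-- The set `B` is homogeneous for the family `X` above the stem `a`. -/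
def IsHomogeneousAbove (X : Set (Set ℕ)) (a : Finset ℕ) (B : Set ℕ) : Prop :=
  (∀ C ⊆ B, C.Infinite → ↑a ∪ C ∈ X) ∨ ∀ C ⊆ B, C.Infinite → ↑a ∪ C ∉ X

/-- A family of sets of natural numbers is completely Ramsey if above any stem any infinite set has
an infinite homogeneous subset. -/
def IsCompletelyRamsey (X : Set (Set ℕ)) : Prop :=
  ∀ (a : Finset ℕ) (A : Set ℕ), A.Infinite → ∃ B ⊆ A, B.Infinite ∧ IsHomogeneousAbove X a B

theorem IsHomogeneousAbove.mono {X : Set (Set ℕ)} {a : Finset ℕ} {A B : Set ℕ}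
    (h : IsHomogeneousAbove X a A) (hBA : B ⊆ A) : IsHomogeneousAbove X a B :=
  h.imp (fun h C hC => h C (hC.trans hBA)) (fun h C hC => h C (hC.trans hBA))

theorem IsCompletelyRamsey.compl {X : Set (Set ℕ)} (hX : IsCompletelyRamsey X) :
    IsCompletelyRamsey Xᶜ := fun a A hA => by
  obtain ⟨B, hBA, hB, h⟩ := hX a A hA
  exact ⟨B, hBA, hB, h.symm.imp_right fun h C hC hi hn => hn (h C hC hi)⟩

/-- Once the infinite part lies above `m`, the trace of `a ∪ C` on `[0, m]` depends on `a` alone. -/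
theorem isCompletelyRamsey_of_agree_below {X : Set (Set ℕ)} (m : ℕ)
    (hX : ∀ C D : Set ℕ, C.Infinite → D.Infinite → (∀ i ≤ m, i ∈ C ↔ i ∈ D) → C ∈ X → D ∈ X) :
    IsCompletelyRamsey X := fun a A hA => by
  refine ⟨aboveFinset {m} A, aboveFinset_subset _ _, hA.aboveFinset _, ?_⟩
  by_cases h : ∃ C ⊆ aboveFinset {m} A, C.Infinite ∧ ↑a ∪ C ∈ X
  · obtain ⟨C, hCA, hC, hCX⟩ := h
    refine Or.inl fun D hDA hD => hX _ _ (hC.mono Set.subset_union_right)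
      (hD.mono Set.subset_union_right) (fun i hi => or_congr_right ?_) hCX
    have hnot : ∀ E ⊆ aboveFinset {m} A, i ∉ E := fun E hE hiE => by
      have := (hE hiE).2 m (by simp)
      omega
    exact iff_of_false (hnot C hCA) (hnot D hDA)
  · exact Or.inr fun C hCA hC hCX => h ⟨C, hCA, hC, hCX⟩

theorem exists_finset_card_of_infinite {D : Set ℕ} (hD : D.Infinite) (n : ℕ) :
    ∃ b : Finset ℕ, b.card = n ∧ ↑b ∪ aboveFinset b D = D := by
  induction n with
  | zero => exact ⟨∅, rfl, by simp [aboveFinset]⟩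
  | succ n ih =>
    obtain ⟨b, hb, hbD⟩ := ih
    have hmem := Nat.sInf_mem (hD.aboveFinset b).nonempty
    set m := sInf (aboveFinset b D)
    refine ⟨insert m b, ?_, ?_⟩
    · rw [Finset.card_insert_of_notMem fun h => (hmem.2 m h).false, hb]
    · refine Set.Subset.antisymm ?_ fun i hi => ?_
      · rw [Finset.coe_insert]
        refine Set.union_subset (Set.insert_subset hmem.1 ?_) (aboveFinset_subset _ _)
        exact Set.subset_union_left.trans hbD.le
      · rw [← hbD] at hi
        rcases hi with hi | hi
        · exact Or.inl (Finset.mem_coe.2 (Finset.mem_insert_of_mem hi))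
        · rcases (Nat.sInf_le hi : m ≤ i).eq_or_lt with rfl | h
          · exact Or.inl (Finset.mem_coe.2 (Finset.mem_insert_self _ _))
          · refine Or.inr ⟨hi.1, fun j hj => ?_⟩
            rcases Finset.mem_insert.1 hj with rfl | hj
            exacts [h, hi.2 j hj]

theorem IsCompletelyRamsey.iUnion {X : ℕ → Set (Set ℕ)} (hX : ∀ n, IsCompletelyRamsey (X n)) :
    IsCompletelyRamsey (⋃ n, X n) := fun a A hA => by
  -- A stem `b` only has to decide the family of index `b.card`. This suffices because an infinite
  -- set has an initial segment of every length: a member of `X n` is examined through its first `n`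
  -- elements.
  obtain ⟨B, hBA, hB, hhom⟩ := exists_fusion
    (P := fun b D => IsHomogeneousAbove (X b.card) (a ∪ b) D)
    (fun b A D h _ hP => hP.mono h) (fun b A hA => hX _ _ A hA) hA
  obtain ⟨C, hCB, hC, h⟩ := exists_accept_or_forall_reject
    (Acc := fun b D => ∀ E ⊆ D, E.Infinite → ↑(a ∪ b) ∪ E ∈ ⋃ n, X n)
    (fun b A D h _ hP E hE => hP E (hE.trans h))
    (fun b D _ hP E hED hE => by
      have hm := Nat.sInf_mem hE.nonempty
      set m := sInf E
      convert hP m (hED hm) (aboveFinset {m} E) (aboveFinset_mono _ hED) (hE.aboveFinset _)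
        using 1
      ext i
      have : i ∈ E ↔ i = m ∨ i ∈ E ∧ m < i := by
        refine ⟨fun hi => ?_, ?_⟩
        · exact (Nat.sInf_le hi : m ≤ i).eq_or_lt.imp Eq.symm fun h => ⟨hi, h⟩
        · rintro (rfl | h)
          exacts [hm, h.1]
      simp only [Finset.coe_union, Finset.coe_insert, Set.mem_union, Set.mem_insert_iff,
        aboveFinset, Set.mem_ofPred_eq, Finset.mem_singleton, forall_eq]
      tauto) hB
  refine ⟨C, hCB.trans hBA, hC, ?_⟩
  rcases h with h | h
  · exact Or.inl (by simpa using h)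
  · refine Or.inr fun D hDC hD hmem => ?_
    obtain ⟨n, hn⟩ := Set.mem_iUnion.1 hmem
    obtain ⟨b, rfl, hbD⟩ := exists_finset_card_of_infinite hD n
    have hb : ↑b ⊆ D := Set.subset_union_left.trans hbD.le
    refine h b (hb.trans hDC) _ subset_rfl (hC.aboveFinset b) fun E hE hEinf => ?_
    have hunion : (↑(a ∪ b) : Set ℕ) ∪ aboveFinset b D = ↑a ∪ D := by
      rw [Finset.coe_union, Set.union_assoc, hbD]
    rcases hhom b (hb.trans (hDC.trans hCB)) with hall | hnone
    · exact Set.mem_iUnion.2 ⟨_, hall E (hE.trans (aboveFinset_mono b hCB)) hEinf⟩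
    · refine absurd hn ?_
      rw [← hunion]
      exact hnone _ (aboveFinset_mono b (hDC.trans hCB)) (hD.aboveFinset b)

/-- The completely Ramsey families form a σ-algebra. -/
@[reducible]
def completelyRamseyMeasurableSpace : MeasurableSpace (Set ℕ) where
  MeasurableSet' := IsCompletelyRamsey
  measurableSet_empty := fun _ A hA => ⟨A, subset_rfl, hA, Or.inr fun _ _ _ h => h⟩
  measurableSet_compl := fun _ h => h.compl
  measurableSet_iUnion := fun _ h => IsCompletelyRamsey.iUnion h

/-! ### The Galvin–Prikry theorem and colorings of the shift on infinite sets -/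

open Classical in
/-- The increasing enumeration of an infinite set (and of `ℕ`, if the set is finite). -/
noncomputable def InfiniteSubset.ofSet (X : Set ℕ) : InfiniteSubset :=
  if h : X.Infinite then ⟨Nat.nth (· ∈ X), Nat.nth_strictMono h⟩ else ⟨id, strictMono_id⟩

open Classical in
theorem InfiniteSubset.ofSet_apply_eq_iff {X : Set ℕ} (hX : X.Infinite) (k m : ℕ) :
    (InfiniteSubset.ofSet X).1 k = m ↔ m ∈ X ∧ Nat.count (· ∈ X) m = k := by
  rw [InfiniteSubset.ofSet, dif_pos hX]
  refine ⟨?_, ?_⟩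
  · rintro rfl
    exact ⟨Nat.nth_mem_of_infinite (p := (· ∈ X)) hX k,
      Nat.count_nth_of_infinite (p := (· ∈ X)) hX k⟩
  · rintro ⟨hm, rfl⟩
    exact Nat.nth_count (p := (· ∈ X)) hm

theorem InfiniteSubset.ofSet_range (A : InfiniteSubset) :
    InfiniteSubset.ofSet (Set.range A.1) = A := by
  have hinf := Set.infinite_range_of_injective A.2.injective
  rw [InfiniteSubset.ofSet, dif_pos hinf]
  refine Subtype.ext ?_
  refine ((Nat.nth_strictMono hinf).range_inj A.2).1 ?_
  rw [Nat.range_nth_of_infinite hinf]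
  rfl

theorem InfiniteSubset.measurable_ofSet :
    @Measurable _ _ completelyRamseyMeasurableSpace (borel InfiniteSubset)
      InfiniteSubset.ofSet := by
  classical
  let := completelyRamseyMeasurableSpace
  rw [← BorelSpace.measurable_eq (α := InfiniteSubset)]
  refine Measurable.subtype_mk (measurable_pi_iff.2 fun k => measurable_to_countable' fun m => ?_)
    (f := fun X => (InfiniteSubset.ofSet X).1) (h := fun X => (InfiniteSubset.ofSet X).2)
  -- That the `k`-th element equals `m` is decided by the trace on `[0, m]`. The default value of
  -- `ofSet` at finite sets plays no role, as only infinite sets are tested.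
  refine isCompletelyRamsey_of_agree_below m fun C D hC hD h hCX => ?_
  have hCX := (InfiniteSubset.ofSet_apply_eq_iff hC k m).1 hCX
  refine (InfiniteSubset.ofSet_apply_eq_iff hD k m).2 ⟨(h m le_rfl).1 hCX.1, ?_⟩
  rw [← hCX.2, Nat.count_eq_card_filter_range, Nat.count_eq_card_filter_range]
  congr 1
  refine Finset.filter_congr fun i hi => (h i (Finset.mem_range.1 hi).le).symm

/-- The **Galvin–Prikry theorem**: Borel sets of infinite sets of natural numbers are Ramsey. -/
theorem InfiniteSubset.exists_homogeneous {U : Set InfiniteSubset}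
    (hU : @MeasurableSet _ (borel InfiniteSubset) U) (A : InfiniteSubset) :
    ∃ A' : InfiniteSubset, Set.range A'.1 ⊆ Set.range A.1 ∧
      ((∀ B : InfiniteSubset, Set.range B.1 ⊆ Set.range A'.1 → B ∈ U) ∨
        ∀ B : InfiniteSubset, Set.range B.1 ⊆ Set.range A'.1 → B ∉ U) := by
  -- Measurability of the preimage is by definition complete Ramseyness, used here with the empty
  -- stem.
  obtain ⟨C, hCA, hC, h⟩ := InfiniteSubset.measurable_ofSet hU ∅ (Set.range A.1)
    (Set.infinite_range_of_injective A.2.injective)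
  have hrange : Set.range (Nat.nth (· ∈ C)) = C := Nat.range_nth_of_infinite hC
  refine ⟨⟨Nat.nth (· ∈ C), Nat.nth_strictMono hC⟩, hrange.subset.trans hCA, ?_⟩
  have hinf : ∀ B : InfiniteSubset, (Set.range B.1).Infinite := fun B =>
    Set.infinite_range_of_injective B.2.injective
  refine h.imp (fun h B hB => ?_) (fun h B hB => ?_)
  · simpa [InfiniteSubset.ofSet_range] using h _ (hB.trans hrange.subset) (hinf B)
  · simpa [InfiniteSubset.ofSet_range] using h _ (hB.trans hrange.subset) (hinf B)

theorem InfiniteSubset.measurable_shift :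
    @Measurable _ _ (borel InfiniteSubset) (borel InfiniteSubset) InfiniteSubset.shift := by
  rw [← BorelSpace.measurable_eq (α := InfiniteSubset)]
  exact Measurable.subtype_mk (measurable_pi_iff.2 fun k =>
    (measurable_pi_apply (X := fun _ : ℕ => ℕ) (k + 1)).comp measurable_subtype_coe)

/-- The composition of two increasing enumerations; it enumerates an infinite subset of `A`. -/
def InfiniteSubset.comp (A B : InfiniteSubset) : InfiniteSubset := ⟨A.1 ∘ B.1, A.2.comp B.2⟩

theorem InfiniteSubset.measurable_comp (A : InfiniteSubset) :
    @Measurable _ _ (borel InfiniteSubset) (borel InfiniteSubset) A.comp := by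
  rw [← BorelSpace.measurable_eq (α := InfiniteSubset)]
  exact Measurable.subtype_mk (measurable_pi_iff.2 fun k =>
    (measurable_from_top (f := A.1)).comp
      ((measurable_pi_apply k).comp measurable_subtype_coe))

theorem InfiniteSubset.range_comp_subset (A B : InfiniteSubset) :
    Set.range (A.comp B).1 ⊆ Set.range A.1 := Set.range_comp_subset_range B.1 A.1

/-- There is no Borel coloring of the shift graph on the infinite subsets of `ℕ` with finitely
many colors. -/
theorem InfiniteSubset.exists_eq_shift {ι : Type*} [Finite ι] (c : InfiniteSubset → ι)
    (hc : ∀ i, @MeasurableSet _ (borel InfiniteSubset) (c ⁻¹' {i})) :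
    ∃ A : InfiniteSubset, c A = c A.shift := by
  have := Fintype.ofFinite ι
  have key : ∀ s : Finset ι, ∃ A : InfiniteSubset, ∀ i ∈ s,
      (∀ B : InfiniteSubset, Set.range B.1 ⊆ Set.range A.1 → c B = i) ∨
        ∀ B : InfiniteSubset, Set.range B.1 ⊆ Set.range A.1 → c B ≠ i := by
    classical
    intro s
    induction s using Finset.induction_on with
    | empty => exact ⟨⟨id, strictMono_id⟩, by simp⟩
    | insert j s _ ih =>
      obtain ⟨A, hA⟩ := ih
      obtain ⟨A', hA', h⟩ := InfiniteSubset.exists_homogeneous (hc j) A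
      refine ⟨A', fun i hi => ?_⟩
      rcases Finset.mem_insert.1 hi with rfl | hi
      · exact h
      · exact (hA i hi).imp (fun h B hB => h B (hB.trans hA')) (fun h B hB => h B (hB.trans hA'))
  obtain ⟨A, hA⟩ := key Finset.univ
  refine ⟨A, ?_⟩
  -- Subsets of `A` either all have the color of `A` or all avoid it; `A` itself excludes the
  -- latter.
  rcases hA (c A) (Finset.mem_univ _) with h | h
  · refine (h A.shift ?_).symm
    rintro _ ⟨k, rfl⟩
    exact ⟨k + 1, rfl⟩
  · exact absurd rfl (h A subset_rfl)

/-! ### Borel structure of the space of bad sequences -/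

section BadSeq

variable {Q : Type u} [Preorder Q]

/-- Countability of `Q` makes the Borel σ-algebra of the power the product σ-algebra, so Borel
measurability can be checked one coordinate at a time. -/
theorem BadSeq.borel_eq_comap [Countable Q] :
    borel (BadSeq Q) = MeasurableSpace.comap (fun X : BadSeq Q => X.1)
      (@MeasurableSpace.pi ℕ (fun _ => Q) (fun _ => ⊤)) := by
  let : TopologicalSpace Q := ⊥
  have : DiscreteTopology Q := ⟨rfl⟩
  let : MeasurableSpace Q := ⊤
  have : BorelSpace Q := ⟨borel_eq_top_of_discrete.symm⟩
  refine (borel_comap (f := fun X : BadSeq Q => X.1)).trans ?_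
  rw [← BorelSpace.measurable_eq (α := ℕ → Q)]

theorem BadSeq.measurable_of_forall_preimage [Countable Q] {W : Type w} {m : MeasurableSpace W}
    {F : W → BadSeq Q} (hF : ∀ k q, MeasurableSet {w | (F w).1 k = q}) :
    @Measurable _ _ m (borel (BadSeq Q)) F := by
  let : MeasurableSpace Q := ⊤
  rw [BadSeq.borel_eq_comap, measurable_comap_iff]
  exact measurable_pi_iff.2 fun k => measurable_to_countable' (hF k)

theorem BadSeq.measurableSet_apply_mem [Countable Q] (k : ℕ) (s : Set Q) :
    @MeasurableSet _ (borel (BadSeq Q)) {X | X.1 k ∈ s} := by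
  let : MeasurableSpace Q := ⊤
  rw [BadSeq.borel_eq_comap]
  exact ⟨{x | x k ∈ s}, measurable_pi_apply (X := fun _ : ℕ => Q) k trivial, rfl⟩

theorem BadSeq.measurable_shift [Countable Q] :
    @Measurable _ _ (borel (BadSeq Q)) (borel (BadSeq Q)) BadSeq.shift :=
  BadSeq.measurable_of_forall_preimage fun k q => BadSeq.measurableSet_apply_mem (k + 1) {q}

theorem BadSeq.polishSpace [Countable Q] : PolishSpace (BadSeq Q) := by
  let : TopologicalSpace Q := ⊥
  have : DiscreteTopology Q := ⟨rfl⟩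
  have hclosed : IsClosed {X : ℕ → Q | ∀ k, ¬ X k ≤ X (k + 1)} := by
    have : {X : ℕ → Q | ∀ k, ¬ X k ≤ X (k + 1)} =
        ⋂ k, (fun X : ℕ → Q => (X k, X (k + 1))) ⁻¹' {p | ¬ p.1 ≤ p.2} := by
      ext
      simp
    rw [this]
    exact isClosed_iInter fun k => (isClosed_discrete _).preimage (by fun_prop)
  have : PolishSpace (ℕ → Q) := { }
  exact hclosed.polishSpace

theorem BadSeq.ne_shift (X : BadSeq Q) : X ≠ X.shift := fun h =>
  X.2 0 (congrFun (congrArg Subtype.val h) 0).le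

/-- The sequence of the values of `φ` along the orbit of a point under `σ`. -/
def BadSeq.itinerary {W : Type w} (σ : W → W) (φ : W → Q) (h : ∀ w, ¬ φ w ≤ φ (σ w)) (w : W) :
    BadSeq Q :=
  ⟨fun k => φ (σ^[k] w), fun k => by
    simpa only [Function.iterate_succ_apply'] using h (σ^[k] w)⟩

theorem BadSeq.measurable_itinerary [Countable Q] {W : Type w} {m : MeasurableSpace W}
    {σ : W → W} (hσ : Measurable σ) {φ : W → Q} (hφ : ∀ q, MeasurableSet (φ ⁻¹' {q}))
    (h : ∀ w, ¬ φ w ≤ φ (σ w)) :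
    @Measurable _ _ m (borel (BadSeq Q)) (BadSeq.itinerary σ φ h) :=
  BadSeq.measurable_of_forall_preimage fun k q => hσ.iterate k (hφ q)

end BadSeq

/-! ### Borel chromatic numbers and finite colorings -/

theorem exists_measurable_coloring_of_borelChromaticNumber_le {V : Type u} [TopologicalSpace V]
    [PolishSpace V] {G : SimpleGraph V} (n : ℕ) (h : borelChromaticNumber G ≤ n) :
    ∃ c : V → Fin n, (∀ i, @MeasurableSet _ (borel V) (c ⁻¹' {i})) ∧
      ∀ x y, G.Adj x y → c x ≠ c y := by
  have hne : {κ : Cardinal.{u} | ∃ (Y : Type u) (_ : TopologicalSpace Y), PolishSpace Y ∧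
      Cardinal.mk Y = κ ∧ ∃ c : G →g (⊤ : SimpleGraph Y),
        @Measurable V Y (borel V) (borel Y) c}.Nonempty :=
    -- The identity is a coloring, as `V` is Polish. Without this the infimum could be the default
    -- value `0` of an empty set, and no coloring could be extracted.
    ⟨_, V, inferInstance, inferInstance, rfl, ⟨id, fun h => h.ne⟩,
      @measurable_id V (borel V)⟩
  obtain ⟨Y, _, _, hcard, c, hc⟩ := csInf_mem hne
  have hle : Cardinal.mk Y ≤ n := hcard.le.trans h
  have : Finite Y := Cardinal.lt_aleph0_iff_finite.1 (hle.trans_lt Cardinal.natCast_lt_aleph0)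
  obtain ⟨e⟩ : Nonempty (Y ↪ Fin n) := by
    rw [← Cardinal.lift_mk_le']
    simpa using hle
  refine ⟨fun x => e (c x), fun i => ?_, fun x y hxy he => (c.map_adj hxy).ne (e.injective he)⟩
  have : IsClosed (e ⁻¹' {i}) := (Set.toFinite _).isClosed
  borelize Y
  exact hc this.measurableSet

theorem borelChromaticNumber_le_of_coloring {V : Type u} [TopologicalSpace V] {G : SimpleGraph V}
    {n : ℕ} (c : V → Fin n) (hc : ∀ i, @MeasurableSet _ (borel V) (c ⁻¹' {i}))
    (hadj : ∀ x y, G.Adj x y → c x ≠ c y) : borelChromaticNumber G ≤ n := by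
  refine csInf_le' ⟨ULift (Fin n), ⊥, ?_, by simp, ⟨fun x => ⟨c x⟩, fun h => ?_⟩, ?_⟩
  · let : TopologicalSpace (ULift.{u} (Fin n)) := ⊥
    have : DiscreteTopology (ULift.{u} (Fin n)) := ⟨rfl⟩
    infer_instance
  · exact fun he => hadj _ _ h (congrArg ULift.down he)
  · let : MeasurableSpace V := borel V
    have h1 : Measurable c := measurable_to_countable' hc
    have h2 : @Measurable _ _ _ ⊤ fun x => (⟨c x⟩ : ULift.{u} (Fin n)) :=
      (measurable_from_top (f := ULift.up.{u})).comp h1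
    exact h2.mono le_rfl le_top

/-! ### Transfer of thinness along Borel selections -/

section Transfer

variable {Q : Type u} [Preorder Q] {R : Type w} [Preorder R]

theorem generatedGraph_shift_adj (X : BadSeq Q) :
    (generatedGraph (BadSeq.shift (Q := Q))).Adj X X.shift :=
  (SimpleGraph.fromRel_adj _ _ _).2 ⟨X.ne_shift, Or.inl rfl⟩

/-- If homogeneity gives the bad alternative on `A`, precomposing `f` with `A.comp` makes it bad on
the whole space; its itineraries then transport `c` to a forbidden finite Borel coloring of the
shift on infinite sets. -/
theorem isBetterQuasiOrder_of_coloring [Countable Q] {ι : Type*} [Finite ι] (c : BadSeq Q → ι)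
    (hc : ∀ i, @MeasurableSet _ (borel (BadSeq Q)) (c ⁻¹' {i})) (hne : ∀ X, c X ≠ c X.shift) :
    IsBetterQuasiOrder Q := by
  intro f hf
  let : MeasurableSpace InfiniteSubset := borel InfiniteSubset
  have hU : MeasurableSet {B : InfiniteSubset | f B ≤ f B.shift} := by
    have : {B : InfiniteSubset | f B ≤ f B.shift} =
        ⋃ (q : Q), f ⁻¹' {q} ∩ InfiniteSubset.shift ⁻¹' (f ⁻¹' Set.Ici q) := by
      ext B
      simp
    rw [this]
    exact MeasurableSet.iUnion fun q =>
      (hf _).inter (InfiniteSubset.measurable_shift (hf _))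
  obtain ⟨A, -, hA | hA⟩ := InfiniteSubset.exists_homogeneous hU ⟨id, strictMono_id⟩
  · exact ⟨A, hA⟩
  have hbad : ∀ B : InfiniteSubset, ¬ f (A.comp B) ≤ f (A.comp B.shift) :=
    fun B => hA (A.comp B) (A.range_comp_subset B)
  have hmeas := BadSeq.measurable_itinerary InfiniteSubset.measurable_shift
    (φ := fun B => f (A.comp B)) (fun q => A.measurable_comp (hf {q})) hbad
  obtain ⟨B, hB⟩ := InfiniteSubset.exists_eq_shift
    (fun B => c (BadSeq.itinerary InfiniteSubset.shift (fun B => f (A.comp B)) hbad B))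
    (fun i => hmeas (hc i))
  exact absurd hB (hne _)

/-- Thinness is transferred along a Borel selection of elements of `Q` that turns bad sequences
into bad sequences. -/
theorem IsCountablyThin.of_selection [Countable Q] [Countable R] (hQ : IsCountablyThin Q)
    (φ : BadSeq R → Q) (hφ : ∀ q, @MeasurableSet _ (borel (BadSeq R)) (φ ⁻¹' {q}))
    (h : ∀ X, ¬ φ X ≤ φ X.shift) : IsCountablyThin R := by
  have := BadSeq.polishSpace (Q := Q)
  obtain ⟨c, hc, hadj⟩ := exists_measurable_coloring_of_borelChromaticNumber_le 3
    (by exact_mod_cast hQ.2)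
  let F := BadSeq.itinerary BadSeq.shift φ h
  have hF : @Measurable _ _ (borel _) (borel _) F :=
    BadSeq.measurable_itinerary BadSeq.measurable_shift hφ h
  -- The itinerary of `X.shift` is definitionally the shift of the itinerary of `X`.
  have hne : ∀ X, c (F X) ≠ c (F X.shift) := fun X =>
    hadj _ _ (generatedGraph_shift_adj (F X))
  refine ⟨isBetterQuasiOrder_of_coloring (fun X => c (F X)) (fun i => hF (hc i)) hne, ?_⟩
  refine le_of_le_of_eq (borelChromaticNumber_le_of_coloring (fun X => c (F X))
    (fun i => hF (hc i)) fun X Y hXY => ?_) (by norm_num)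
  obtain ⟨-, rfl | rfl⟩ := (SimpleGraph.fromRel_adj _ _ _).1 hXY
  exacts [hne X, (hne Y).symm]

end Transfer

/-! ### Finite subsets under domination -/

section FiniteSubsets

variable {Q : Type u} [Preorder Q]

theorem IsThin.finiteSubset (hQ : IsThin Q) : IsThin (FiniteSubset Q) := by
  intro s hs
  let t : Set Q := ⋃ a ∈ s, ↑a.toFinset
  have ht : t.Countable := hs.biUnion fun a _ => a.toFinset.countable_toSet
  have := hs.to_subtype
  have := ht.to_subtype
  have hsel : ∀ p : {p : s × s // ¬ p.1 ≤ p.2}, ∃ x : t, x.1 ∈ p.1.1.1.toFinset ∧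
      ∀ y ∈ p.1.2.1.toFinset, ¬ x.1 ≤ y := by
    rintro ⟨⟨a, b⟩, hab⟩
    have hab : ¬ ∀ x ∈ a.1.toFinset, ∃ y ∈ b.1.toFinset, x ≤ y := hab
    push Not at hab
    obtain ⟨x, hx, hxy⟩ := hab
    exact ⟨⟨x, Set.mem_biUnion a.2 hx⟩, hx, hxy⟩
  choose g hg hg' using hsel
  refine (hQ t ht).of_selection (fun X => g ⟨(X.1 0, X.1 1), X.2 0⟩) (fun q => ?_) fun X h => ?_
  · have : (fun X : BadSeq s => g ⟨(X.1 0, X.1 1), X.2 0⟩) ⁻¹' {q} =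
        ⋃ a : s, {X | X.1 0 ∈ ({a} : Set s)} ∩
          {X | X.1 1 ∈ {b : s | ∃ h : ¬ a ≤ b, g ⟨(a, b), h⟩ = q}} := by
      ext X
      simp only [Set.mem_preimage, Set.mem_singleton_iff, Set.mem_iUnion, Set.mem_inter_iff,
        Set.mem_ofPred_eq]
      refine ⟨fun h => ⟨_, rfl, X.2 0, h⟩, ?_⟩
      rintro ⟨_, rfl, _, h⟩
      exact h
    rw [this]
    let : MeasurableSpace (BadSeq s) := borel _
    exact MeasurableSet.iUnion fun a =>
      (BadSeq.measurableSet_apply_mem 0 _).inter (BadSeq.measurableSet_apply_mem 1 _)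
  -- The element selected for `X.shift` lies in `X 1`, whereas the one selected for `X` is below no
  -- element of `X 1`.
  · exact hg' ⟨(X.1 0, X.1 1), X.2 0⟩ _ (hg ⟨(X.shift.1 0, X.shift.1 1), X.shift.2 0⟩) h

end FiniteSubsets

/-! ### Descent to witnesses of smaller rank -/

section Descent

variable {Q : Type u} [Preorder Q] {P : Type w} [Preorder P]

/-- Thinness of `P` follows from that of `Q` if every failure of `p ≤ q` in `P` either is witnessed
by the labels in `Q`, or is inherited from an element below `p` of smaller rank. -/
theorem IsCountablyThin.of_descent [Countable Q] [Countable P] (hQ : IsCountablyThin Q)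
    (lab : P → Q) (rank : P → ℕ)
    (h : ∀ p q, ¬ p ≤ q → ¬ lab p ≤ lab q ∨ ∃ p' ≤ p, ¬ p' ≤ q ∧ rank p' < rank p) :
    IsCountablyThin P := by
  have hnext : ∀ p q : P, ∃ p', ¬ p ≤ q → p' ≤ p ∧ ¬ p' ≤ q ∧
      (rank p' < rank p ∨ p' = p ∧ ¬ lab p ≤ lab q) := by
    intro p q
    by_cases hpq : p ≤ q
    · exact ⟨p, fun h => absurd hpq h⟩
    rcases h p q hpq with hlab | ⟨p', h1, h2, h3⟩
    · exact ⟨p, fun _ => ⟨le_rfl, hpq, Or.inr ⟨rfl, hlab⟩⟩⟩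
    · exact ⟨p', fun _ => ⟨h1, h2, Or.inl h3⟩⟩
  choose next hnext using hnext
  -- The new `k`-th entry is still not below `X (k + 1)`, which dominates the new entry at `k + 1`;
  -- hence badness persists.
  let advance : BadSeq P → BadSeq P := fun X => ⟨fun k => next (X.1 k) (X.1 (k + 1)), fun k hle =>
    (hnext _ _ (X.2 k)).2.1 (hle.trans (hnext _ _ (X.2 (k + 1))).1)⟩
  let : MeasurableSpace (BadSeq P) := borel _
  have hmeas : Measurable advance := by
    refine BadSeq.measurable_of_forall_preimage fun k p => ?_
    have : {X : BadSeq P | (advance X).1 k = p} =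
        ⋃ a : P, {X | X.1 k ∈ ({a} : Set P)} ∩ {X | X.1 (k + 1) ∈ {b | next a b = p}} := by
      ext X
      simp [advance]
    rw [this]
    exact MeasurableSet.iUnion fun a =>
      (BadSeq.measurableSet_apply_mem _ _).inter (BadSeq.measurableSet_apply_mem _ _)
  have hshift : ∀ n X, advance^[n] X.shift = (advance^[n] X).shift := fun n X =>
    (Function.Commute.iterate_left (f := advance) (g := BadSeq.shift) (fun _ => rfl) n) X
  have hstep : ∀ n X, rank ((advance^[n + 1] X).1 0) < rank ((advance^[n] X).1 0) ∨
      (advance^[n + 1] X).1 0 = (advance^[n] X).1 0 ∧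
        ¬ lab ((advance^[n] X).1 0) ≤ lab ((advance^[n] X).1 1) := fun n X => by
    rw [Function.iterate_succ_apply']
    exact (hnext _ _ ((advance^[n] X).2 0)).2.2
  have hstab : ∀ X, ∃ p, ∃ N, ∀ n ≥ N, (advance^[n] X).1 0 = p ∧
      ¬ lab ((advance^[n] X).1 0) ≤ lab ((advance^[n] X).1 1) := by
    intro X
    -- Beyond a stage of minimal rank no strict drop is possible, so the entry is constant and every
    -- later step must be a failure of labels.
    obtain ⟨N, hN⟩ : ∃ N, ∀ n, rank ((advance^[N] X).1 0) ≤ rank ((advance^[n] X).1 0) :=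
      ⟨_, fun n => Function.argmin_le (fun n => rank ((advance^[n] X).1 0)) n⟩
    have hconst : ∀ n ≥ N, (advance^[n] X).1 0 = (advance^[N] X).1 0 := by
      intro n hn
      induction n, hn using Nat.le_induction with
      | base => rfl
      | succ n _ ih =>
        rcases hstep n X with hlt | heq
        · rw [ih] at hlt
          exact absurd hlt (hN (n + 1)).not_gt
        · exact heq.1.trans ih
    refine ⟨_, N, fun n hn => ⟨hconst n hn, ?_⟩⟩
    rcases hstep n X with hlt | heq
    · rw [hconst n hn] at hlt
      exact absurd hlt (hN (n + 1)).not_gt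
    · exact heq.2
  choose lim N hlim using hstab
  refine hQ.of_selection (fun X => lab (lim X)) (fun q => ?_) fun X hle => ?_
  -- The limit label is the eventual value of a sequence of Borel functions, so its fibers are
  -- countable unions of countable intersections of Borel sets.
  · have : (fun X => lab (lim X)) ⁻¹' {q} =
        ⋃ M : ℕ, ⋂ n : ℕ, advance^[n + M] ⁻¹' {X | X.1 0 ∈ lab ⁻¹' {q}} := by
      ext X
      simp only [Set.mem_preimage, Set.mem_singleton_iff, Set.mem_iUnion, Set.mem_iInter,
        Set.mem_ofPred_eq]
      refine ⟨fun h => ⟨N X, fun n => ?_⟩, ?_⟩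
      · rw [(hlim X _ (Nat.le_add_left _ _)).1, h]
      · rintro ⟨M, hM⟩
        have := hM (N X)
        rwa [(hlim X _ (Nat.le_add_right _ _)).1] at this
    rw [this]
    exact MeasurableSet.iUnion fun M => MeasurableSet.iInter fun n =>
      hmeas.iterate _ (BadSeq.measurableSet_apply_mem 0 _)
  · have h1 := hlim X _ (le_max_left (N X) (N X.shift))
    have h2 := hlim X.shift _ (le_max_right (N X) (N X.shift))
    rw [hshift] at h2
    refine h1.2 ?_
    rw [h1.1]
    exact hle.trans_eq (congrArg lab h2.1.symm)

end Descent

/-! ### Labelled finite trees and their subtrees -/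

section FiniteTrees

/-- A labelled finite tree with a distinguished node; it stands for the subtree of the nodes above
the distinguished one. -/
structure PointedTree (Q : Type u) : Type (max u (v + 1)) where
  /-- the ambient tree -/
  tree : LabelledFiniteTree.{u, v} Q
  /-- the root of the subtree -/
  node : tree.Node

/-- The relation `≤_m` between the subtrees above the distinguished nodes. -/
instance PointedTree.instPreorder (Q : Type u) [Preorder Q] :
    Preorder (PointedTree.{u, v} Q) where
  le S T := ∃ f : S.tree.Node → T.tree.Node, (∀ a b, S.node ≤ a → a ≤ b → f a ≤ f b) ∧
    (∀ a, S.node ≤ a → S.tree.label a ≤ T.tree.label (f a)) ∧ ∀ a, S.node ≤ a → T.node ≤ f a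
  le_refl S := ⟨id, fun _ _ _ h => h, fun _ _ => le_rfl, fun _ h => h⟩
  le_trans R S T := by
    rintro ⟨f, hf, hf', hf''⟩ ⟨g, hg, hg', hg''⟩
    exact ⟨fun a => g (f a), fun a b h1 h2 => hg _ _ (hf'' a h1) (hf a b h1 h2),
      fun a h => (hf' a h).trans (hg' _ (hf'' a h)), fun a h => hg'' _ (hf'' a h)⟩

theorem LabelledFiniteTree.le_total_of_le {Q : Type u} (T : LabelledFiniteTree.{u, v} Q)
    {a b t : T.Node} (ha : a ≤ t) (hb : b ≤ t) : a ≤ b ∨ b ≤ a := by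
  have := T.wellOrdered t
  rcases trichotomous_of (fun a b : {s : T.Node // s ≤ t} => a < b) ⟨a, ha⟩ ⟨b, hb⟩ with h | h | h
  · exact Or.inl (Subtype.mk_lt_mk.1 h).le
  · exact Or.inl (Subtype.mk.inj h).le
  · exact Or.inr (Subtype.mk_lt_mk.1 h).le

/-- This is the child of `x` on the branch to `a`: the nodes below `a` form a chain, so a minimal
one above `x` is least. -/
theorem LabelledFiniteTree.exists_least_between {Q : Type u} (T : LabelledFiniteTree.{u, v} Q)
    {x a : T.Node} (h : x < a) : ∃ c, x < c ∧ c ≤ a ∧ ∀ w, x < w → w ≤ a → c ≤ w := by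
  have := T.finite
  obtain ⟨c, hc⟩ := (Set.toFinite {w | x < w ∧ w ≤ a}).exists_minimal ⟨a, h, le_rfl⟩
  refine ⟨c, hc.prop.1, hc.prop.2, fun w hw hwa => ?_⟩
  exact (T.le_total_of_le hc.prop.2 hwa).elim id (hc.le_of_le ⟨hw, hwa⟩)

/-- A tree is below another one if its root label is below the other root label and all proper
subtrees are below the other tree. -/
theorem PointedTree.le_of_label_le {Q : Type u} [Preorder Q] {S T : PointedTree.{u, v} Q}
    (hlab : S.tree.label S.node ≤ T.tree.label T.node)
    (h : ∀ z, S.node < z → (⟨S.tree, z⟩ : PointedTree Q) ≤ T) : S ≤ T := by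
  classical
  have hc : ∀ a, ∃ c, S.node < a → S.node < c ∧ c ≤ a ∧ ∀ w, S.node < w → w ≤ a → c ≤ w := by
    intro a
    by_cases ha : S.node < a
    · obtain ⟨c, hc⟩ := S.tree.exists_least_between ha
      exact ⟨c, fun _ => hc⟩
    · exact ⟨a, fun h => absurd h ha⟩
  have hg : ∀ z, ∃ f : S.tree.Node → T.tree.Node, S.node < z →
      (∀ a b, z ≤ a → a ≤ b → f a ≤ f b) ∧
      (∀ a, z ≤ a → S.tree.label a ≤ T.tree.label (f a)) ∧ ∀ a, z ≤ a → T.node ≤ f a := by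
    intro z
    by_cases hz : S.node < z
    · obtain ⟨f, hf⟩ := h z hz
      exact ⟨f, fun _ => hf⟩
    · exact ⟨fun _ => T.node, fun h => absurd h hz⟩
  choose c hc using hc
  choose g hg using hg
  -- Comparable nodes above the root lie over the same child, so the glued map uses a single `g` on
  -- both. Different branches need no compatibility, because maps need not be injective.
  have hceq : ∀ a b, S.node < a → a ≤ b → c a = c b := by
    intro a b ha hab
    obtain ⟨h1, h2, h3⟩ := hc a ha
    obtain ⟨k1, k2, k3⟩ := hc b (ha.trans_le hab)
    have hba := k3 _ h1 (h2.trans hab)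
    exact le_antisymm (h3 _ k1 (hba.trans h2)) hba
  have hroot : ∀ a, S.node ≤ a → T.node ≤ if S.node < a then g (c a) a else T.node := by
    intro a _
    split_ifs with ha
    exacts [(hg _ (hc a ha).1).2.2 a (hc a ha).2.1, le_rfl]
  refine ⟨fun a => if S.node < a then g (c a) a else T.node, fun a b ha hab => ?_,
    fun a ha => ?_, hroot⟩
  · by_cases hlt : S.node < a
    · simp only [if_pos hlt, if_pos (hlt.trans_le hab), ← hceq a b hlt hab]
      exact (hg _ (hc a hlt).1).1 a b (hc a hlt).2.1 hab
    · simp only [if_neg hlt]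
      exact hroot b (ha.trans hab)
  · rcases ha.eq_or_lt with rfl | hlt
    · simpa using hlab
    · simp only [if_pos hlt]
      exact (hg _ (hc a hlt).1).2.1 a (hc a hlt).2.1

theorem PointedTree.mk_le_of_le {Q : Type u} [Preorder Q] (T : LabelledFiniteTree.{u, v} Q)
    {x y : T.Node} (h : x ≤ y) : (⟨T, y⟩ : PointedTree Q) ≤ ⟨T, x⟩ :=
  ⟨id, fun _ _ _ h => h, fun _ _ => le_rfl, fun _ h' => h.trans h'⟩

theorem LabelledFiniteTree.le_of_pointed_le {Q : Type u} [Preorder Q]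
    {S T : LabelledFiniteTree.{u, v} Q} {x : S.Node} {y : T.Node} (hx : ∀ t, x ≤ t)
    (h : (⟨S, x⟩ : PointedTree Q) ≤ ⟨T, y⟩) : S ≤ T := by
  obtain ⟨f, hf, hf', -⟩ := h
  exact ⟨f, fun a b => hf a b (hx a), fun a => hf' a (hx a)⟩

theorem IsThin.labelledFiniteTree {Q : Type u} [Preorder Q] (hQ : IsThin Q) :
    IsThin (LabelledFiniteTree.{u, v} Q) := by
  intro s hs
  have := hs.to_subtype
  have (T : LabelledFiniteTree.{u, v} Q) : Finite T.Node := T.finite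
  let t : Set Q := Set.range fun p : (T : s) × T.1.Node => p.1.1.label p.2
  -- All subtrees of the given trees are included, so the descent stays inside one countable set.
  let P : Set (PointedTree.{u, v} Q) := {p | p.tree ∈ s}
  have hP : P.Countable := by
    refine (Set.countable_range
      fun p : (T : s) × T.1.Node => (⟨p.1.1, p.2⟩ : PointedTree Q)).mono ?_
    rintro ⟨T, x⟩ hT
    exact ⟨⟨⟨T, hT⟩, x⟩, rfl⟩
  have := hP.to_subtype
  have : Countable t := (Set.countable_range _).to_subtype
  have hthin : IsCountablyThin P := by
    refine (hQ t (Set.countable_range _)).of_descent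
      (fun p => ⟨p.1.tree.label p.1.node, ⟨⟨⟨p.1.tree, p.2⟩, p.1.node⟩, rfl⟩⟩)
      -- Passing to the subtree at `z` above the node loses at least `z` itself from this count.
      (fun p => (Set.Ioi p.1.node).ncard) fun p q hpq => ?_
    by_contra! hcon
    refine hpq (PointedTree.le_of_label_le hcon.1 fun z hz => ?_)
    by_contra hzq
    refine (hcon.2 ⟨⟨p.1.tree, z⟩, p.2⟩ (PointedTree.mk_le_of_le _ hz.le) hzq).not_gt ?_
    exact Set.ncard_lt_ncard ⟨Set.Ioi_subset_Ioi hz.le, fun h => (h hz).false⟩ (Set.toFinite _)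
  choose root hroot using fun T : LabelledFiniteTree.{u, v} Q => T.exists_root
  -- A tree is identified with its subtree at the root, which reflects the order; only the first
  -- entry of a bad sequence is needed.
  refine hthin.of_selection (fun X => ⟨⟨(X.1 0).1, root (X.1 0).1⟩, (X.1 0).2⟩) (fun p => ?_)
    fun X h => X.2 0 (LabelledFiniteTree.le_of_pointed_le (hroot _) h)
  exact BadSeq.measurableSet_apply_mem 0
    {T : s | (⟨⟨T.1, root T.1⟩, T.2⟩ : P) = p}

end FiniteTrees

theorem corollary3p8 {Q : Type u} [Preorder Q] (hQ : IsThin Q) :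
    IsThin (FiniteSubset Q) ∧ IsThin (LabelledFiniteTree.{u, v} Q) :=
  ⟨hQ.finiteSubset, hQ.labelledFiniteTree⟩
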